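/- Let $H$ be a Hilbert module over a $C^*$-algebra, and let $\mathcal{L}(H,K)$ denote the adjointable operators from $H$ to $K$, with $\mathcal{L}(H)=\mathcal{L}(H,H)$. A projection is a self-adjoint idempotent. Write $\mathcal{R}(T)$ and $\mathcal{N}(T)$ for the range and the null space of $T$, and $I$ for the identity operator. A closed submodule $M$ of $H$ is orthogonally complemented if $H=M+M^\perp$. Let $P\in\mathcal{L}(H)$ be a non-trivial projection, that is, $P\neq 0$ and $P\neq I$, and let $U_P: H\to \mathcal{R}(P)\oplus\mathcal{N}(P)$ be the unitary operator $U_Ph=(Ph,(I-P)h)$. An operator $Q\in\mathcal{L}(H)$ is said to have the canonical $2\times 2$ block matrix representation induced by $P$ if there are a self-adjoint $A\in\mathcal{L}(\mathcal{R}(P))$ with $A^2-A\geq 0$, a partial isometry $U\in\mathcal{L}(\mathcal{R}(P),\mathcal{N}(P))$ with $\mathcal{R}(U^*)=\overline{\mathcal{R}(A^2-A)}$, and a projection $Q_0\in\mathcal{L}(\mathcal{N}(P))$ with $U^*Q_0=0$, such that $$U_PQU_P^*=\begin{pmatrix} A & -\ell(A)U^*\\ U\ell(A) & U(I_{\mathcal{R}(P)}-A)U^*+Q_0\end{pmatrix},\qquad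 \ell(A)=(A^2-A)^{1/2}.$$ The pair $(P,Q)$ is called a quasi-projection pair if $P$ is a projection and $Q$ is an idempotent with $$PQ^*P=PQP,\quad PQ^*(I-P)=-PQ(I-P),\quad (I-P)Q^*(I-P)=(I-P)Q(I-P);$$ it is harmonious if in addition $\overline{\mathcal{R}(PQ(I-P))}$ and $\overline{\mathcal{R}((I-P)QP)}$ are both orthogonally complemented in $H$. **Theorem.** Let $P\in\mathcal{L}(H)$ be a non-trivial projection. Then for every $Q\in\mathcal{L}(H)$, $Q$ has the canonical $2\times 2$ block matrix representation induced by $P$ if and only if $(P,Q)$ is a harmonious quasi-projection pair. -/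

import Mathlib

open scoped InnerProductSpace WithCStarModule

noncomputable section

namespace HilbertModule

/-! ## Adjointable operators between Hilbert C*-modules -/

/-- An adjointable operator `E → F` between Hilbert `A`-modules, packaged together with its adjoint.
(The adjoint is determined by the operator, see `Adjointable.ext`, and an operator with an adjoint is
automatically `A`-linear, see `Adjointable.map_op_smul`. On Hilbert modules boundedness is automatic
too, by the closed graph theorem.)

Hilbert modules are Mathlib's `CStarModule`s that are complete, with the inner product linear in the
second variable. Mathlib writes the module action on the left, `⟪x, a • y⟫ = a * ⟪x, y⟫`; a right
Hilbert module over `B` is the case `A = Bᵐᵒᵖ`, with the same adjointable operators. -/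
structure Adjointable (A E F : Type*) [NonUnitalCStarAlgebra A] [PartialOrder A]
    [NormedAddCommGroup E] [NormedSpace ℂ E] [SMul A E] [CStarModule A E]
    [NormedAddCommGroup F] [NormedSpace ℂ F] [SMul A F] [CStarModule A F] where
  /-- the operator -/
  toCLM : E →L[ℂ] F
  /-- its adjoint -/
  adjCLM : F →L[ℂ] E
  inner_adj : ∀ (x : E) (y : F), ⟪toCLM x, y⟫_A = ⟪x, adjCLM y⟫_A

section Operators

variable {A E F G : Type*} [NonUnitalCStarAlgebra A] [PartialOrder A]
  [NormedAddCommGroup E] [NormedSpace ℂ E] [SMul A E] [CStarModule A E]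
  [NormedAddCommGroup F] [NormedSpace ℂ F] [SMul A F] [CStarModule A F]
  [NormedAddCommGroup G] [NormedSpace ℂ G] [SMul A G] [CStarModule A G]

theorem eq_of_inner_left {x y : E} (h : ∀ z : E, ⟪z, x⟫_A = ⟪z, y⟫_A) : x = y := by
  rw [← sub_eq_zero, ← CStarModule.inner_self (A := A), CStarModule.inner_sub_right, h, sub_self]

namespace Adjointable

instance : CoeFun (Adjointable A E F) (fun _ => E → F) := ⟨fun T => T.toCLM⟩

/-- The adjoint `T*` of an adjointable operator. -/
def adjoint (T : Adjointable A E F) : Adjointable A F E where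
  toCLM := T.adjCLM
  adjCLM := T.toCLM
  inner_adj x y := by
    rw [← CStarModule.star_inner, ← T.inner_adj, CStarModule.star_inner]

theorem toCLM_injective : Function.Injective (toCLM : Adjointable A E F → E →L[ℂ] F) := by
  rintro ⟨T, S, h⟩ ⟨T', S', h'⟩ hT
  obtain rfl : T = T' := hT
  obtain rfl : S = S' := by
    ext y
    exact eq_of_inner_left (A := A) fun z => by rw [← h, ← h']
  rfl

@[ext]
theorem ext {S T : Adjointable A E F} (h : ∀ x, S x = T x) : S = T :=
  toCLM_injective (ContinuousLinearMap.ext h)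

/-- Adjointable operators are `A`-linear. -/
theorem map_op_smul (T : Adjointable A E F) (a : A) (x : E) : T (a • x) = a • T x := by
  refine eq_of_inner_left (A := A) fun z => ?_
  have h (y : E) : ⟪z, T y⟫_A = ⟪T.adjoint z, y⟫_A := (T.adjoint.inner_adj z y).symm
  rw [h, CStarModule.inner_op_smul_right, CStarModule.inner_op_smul_right, h]

/-- The identity operator. -/
def id (A E : Type*) [NonUnitalCStarAlgebra A] [PartialOrder A]
    [NormedAddCommGroup E] [NormedSpace ℂ E] [SMul A E] [CStarModule A E] :
    Adjointable A E E where
  toCLM := ContinuousLinearMap.id ℂ E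
  adjCLM := ContinuousLinearMap.id ℂ E
  inner_adj _ _ := rfl

/-- Composition `S ∘ T`. -/
def comp (S : Adjointable A F G) (T : Adjointable A E F) : Adjointable A E G where
  toCLM := S.toCLM.comp T.toCLM
  adjCLM := T.adjCLM.comp S.adjCLM
  inner_adj x y := by
    simp only [ContinuousLinearMap.comp_apply]
    rw [S.inner_adj, T.inner_adj]

instance : Zero (Adjointable A E F) := ⟨⟨0, 0, fun x y => by simp⟩⟩

instance : Add (Adjointable A E F) :=
  ⟨fun S T => ⟨S.toCLM + T.toCLM, S.adjCLM + T.adjCLM, fun x y => by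
    simp [S.inner_adj, T.inner_adj]⟩⟩

instance : Neg (Adjointable A E F) :=
  ⟨fun T => ⟨-T.toCLM, -T.adjCLM, fun x y => by simp [T.inner_adj]⟩⟩

instance : Sub (Adjointable A E F) :=
  ⟨fun S T => ⟨S.toCLM - T.toCLM, S.adjCLM - T.adjCLM, fun x y => by
    simp [S.inner_adj, T.inner_adj]⟩⟩

instance : SMul ℂ (Adjointable A E F) :=
  ⟨fun c T => ⟨c • T.toCLM, star c • T.adjCLM, fun x y => by simp [T.inner_adj]⟩⟩

instance : SMul ℕ (Adjointable A E F) :=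
  ⟨fun n T => ⟨n • T.toCLM, n • T.adjCLM, fun x y => by
    simp [← Nat.cast_smul_eq_nsmul ℂ, T.inner_adj]⟩⟩

instance : SMul ℤ (Adjointable A E F) :=
  ⟨fun n T => ⟨n • T.toCLM, n • T.adjCLM, fun x y => by
    simp [← Int.cast_smul_eq_zsmul ℂ, T.inner_adj]⟩⟩

instance : AddCommGroup (Adjointable A E F) :=
  toCLM_injective.addCommGroup toCLM rfl (fun _ _ => rfl) (fun _ => rfl) (fun _ _ => rfl)
    (fun _ _ => rfl) (fun _ _ => rfl)

instance : Module ℂ (Adjointable A E F) :=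
  toCLM_injective.module ℂ ⟨⟨toCLM, rfl⟩, fun _ _ => rfl⟩ (fun _ _ => rfl)

/-! ### The C*-algebra of adjointable operators on `E` -/

instance : Ring (Adjointable A E E) where
  mul := comp
  one := id A E
  left_distrib S T R := by ext x; exact map_add S.toCLM _ _
  right_distrib S T R := by ext x; rfl
  zero_mul T := by ext x; rfl
  mul_zero T := by ext x; exact map_zero T.toCLM
  mul_assoc S T R := by ext x; rfl
  one_mul T := by ext x; rfl
  mul_one T := by ext x; rfl
  neg_add_cancel T := neg_add_cancel T
  zsmul := (· • ·)
  zsmul_zero' := zero_zsmul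
  zsmul_succ' n T := SubNegMonoid.zsmul_succ' n T
  zsmul_neg' n T := SubNegMonoid.zsmul_neg' n T
  sub_eq_add_neg := sub_eq_add_neg

instance : StarRing (Adjointable A E E) where
  star := adjoint
  star_involutive _ := rfl
  star_mul S T := by ext x; rfl
  star_add S T := by ext x; rfl

instance : StarModule ℂ (Adjointable A E E) where
  star_smul c T := by ext x; rfl

instance : Algebra ℂ (Adjointable A E E) :=
  Algebra.ofModule (fun c S T => by ext x; rfl)
    (fun c S T => by ext x; exact map_smul S.toCLM c (T x))

/-- The inclusion of the adjointable operators in the bounded operators. -/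
def toCLMHom : Adjointable A E E →ₐ[ℂ] (E →L[ℂ] E) :=
  AlgHom.ofLinearMap ⟨⟨toCLM, fun _ _ => rfl⟩, fun _ _ => rfl⟩ rfl (fun _ _ => rfl)

/-- `𝓛(E)` carries the operator norm. -/
instance : NormedRing (Adjointable A E E) :=
  NormedRing.induced _ _ (toCLMHom (A := A) (E := E)) toCLM_injective

instance : NormedAlgebra ℂ (Adjointable A E E) where
  norm_smul_le c T := norm_smul_le c T.toCLM

theorem norm_def (T : Adjointable A E E) : ‖T‖ = ‖T.toCLM‖ := rfl

variable [StarOrderedRing A]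

theorem norm_sq_le (T : Adjointable A E E) : ‖T‖ * ‖T‖ ≤ ‖star T * T‖ := by
  rw [← sq, ← Real.le_sqrt (norm_nonneg _) (norm_nonneg _), norm_def]
  refine ContinuousLinearMap.opNorm_le_bound _ (Real.sqrt_nonneg _) fun x => ?_
  have h : ‖T x‖ ^ 2 ≤ ‖star T * T‖ * ‖x‖ ^ 2 := by
    calc ‖T x‖ ^ 2 = ‖⟪x, (star T * T) x⟫_A‖ := by
          rw [CStarModule.norm_sq_eq A, T.inner_adj]; rfl
      _ ≤ ‖x‖ * ‖(star T * T) x‖ := CStarModule.norm_inner_le E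
      _ ≤ ‖x‖ * (‖star T * T‖ * ‖x‖) := by
          gcongr; exact (star T * T).toCLM.le_opNorm x
      _ = ‖star T * T‖ * ‖x‖ ^ 2 := by ring
  calc ‖T x‖ = √(‖T x‖ ^ 2) := (Real.sqrt_sq (norm_nonneg _)).symm
    _ ≤ √(‖star T * T‖ * ‖x‖ ^ 2) := Real.sqrt_le_sqrt h
    _ = √‖star T * T‖ * ‖x‖ := by
        rw [Real.sqrt_mul (norm_nonneg _), Real.sqrt_sq (norm_nonneg _)]

instance : CStarRing (Adjointable A E E) where
  norm_mul_self_le := norm_sq_le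

instance [CompleteSpace E] : CompleteSpace (Adjointable A E E) := by
  refine Metric.complete_of_cauchySeq_tendsto fun u hu => ?_
  have h1 : CauchySeq fun n => (u n).toCLM := by
    rw [Metric.cauchySeq_iff] at hu ⊢
    intro ε hε
    obtain ⟨N, hN⟩ := hu ε hε
    exact ⟨N, fun m hm n hn => by simpa [dist_eq_norm] using! hN m hm n hn⟩
  have h2 : CauchySeq fun n => (u n).adjCLM := by
    rw [Metric.cauchySeq_iff] at hu ⊢
    intro ε hε
    obtain ⟨N, hN⟩ := hu ε hε
    refine ⟨N, fun m hm n hn => ?_⟩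
    have := hN m hm n hn
    rw [dist_eq_norm, ← norm_star] at this
    rw [dist_eq_norm]
    exact this
  obtain ⟨T, hT⟩ := cauchySeq_tendsto_of_complete h1
  obtain ⟨S, hS⟩ := cauchySeq_tendsto_of_complete h2
  have hTS : ∀ x y : E, ⟪T x, y⟫_A = ⟪x, S y⟫_A := by
    intro x y
    have hTx : Filter.Tendsto (fun n => (u n).toCLM x) Filter.atTop (nhds (T x)) :=
      ((ContinuousLinearMap.apply ℂ E x).continuous.tendsto T).comp hT
    have hSy : Filter.Tendsto (fun n => (u n).adjCLM y) Filter.atTop (nhds (S y)) :=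
      ((ContinuousLinearMap.apply ℂ E y).continuous.tendsto S).comp hS
    have l1 := ((CStarModule.continuous_inner (A := A) (E := E)).tendsto (T x, y)).comp
      (hTx.prodMk_nhds tendsto_const_nhds)
    have l2 := ((CStarModule.continuous_inner (A := A) (E := E)).tendsto (x, S y)).comp
      ((tendsto_const_nhds (x := x)).prodMk_nhds hSy)
    refine tendsto_nhds_unique l1 (l2.congr fun n => ?_)
    exact ((u n).inner_adj x y).symm
  refine ⟨⟨T, S, hTS⟩, ?_⟩
  rw [tendsto_iff_norm_sub_tendsto_zero] at hT ⊢
  exact hT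

instance [CompleteSpace E] : CStarAlgebra (Adjointable A E E) where

/-- The usual order of the C*-algebra `𝓛(E)`. -/
instance [CompleteSpace E] : PartialOrder (Adjointable A E E) := CStarAlgebra.spectralOrder _

instance [CompleteSpace E] : StarOrderedRing (Adjointable A E E) :=
  CStarAlgebra.spectralOrderedRing _

end Adjointable

/-- Partial isometries. -/
def IsPartialIsometry (U : Adjointable A E F) : Prop :=
  (U.comp U.adjoint).comp U = U

end Operators

/-! ## Closed submodules and orthogonal complements -/

/-- A closed submodule of a Hilbert `A`-module. -/
structure HilbertSubmodule (A E : Type*) [NonUnitalCStarAlgebra A] [PartialOrder A]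
    [NormedAddCommGroup E] [NormedSpace ℂ E] [SMul A E] [CStarModule A E]
    extends Submodule ℂ E where
  op_smul_mem' : ∀ (a : A) {x : E}, x ∈ carrier → a • x ∈ carrier
  isClosed' : IsClosed carrier

section Submodules

variable {A E : Type*} [NonUnitalCStarAlgebra A] [PartialOrder A]
  [NormedAddCommGroup E] [NormedSpace ℂ E] [SMul A E] [CStarModule A E]

instance : CoeSort (HilbertSubmodule A E) (Type _) := ⟨fun M => M.toSubmodule⟩

instance (M : HilbertSubmodule A E) : SMul A M :=
  ⟨fun a x => ⟨a • (x : E), M.op_smul_mem' a x.2⟩⟩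

/-- A closed submodule is itself a Hilbert `A`-module, with the restricted inner product. -/
instance (M : HilbertSubmodule A E) : CStarModule A M where
  inner x y := ⟪(x : E), (y : E)⟫_A
  inner_add_right {x y z} := CStarModule.inner_add_right
  inner_self_nonneg {x} := CStarModule.inner_self_nonneg
  inner_self {x} := by rw [CStarModule.inner_self, ZeroMemClass.coe_eq_zero]
  inner_op_smul_right {a x y} := CStarModule.inner_op_smul_right
  inner_smul_right_complex {z x y} := CStarModule.inner_smul_right_complex
  star_inner x y := CStarModule.star_inner _ _
  norm_eq_sqrt_norm_inner_self x := CStarModule.norm_eq_sqrt_norm_inner_self (A := A) (x : E)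

instance [CompleteSpace E] (M : HilbertSubmodule A E) : CompleteSpace M :=
  M.isClosed'.completeSpace_coe

/-- The null space `𝓝(T)`. -/
def nullSpace (T : Adjointable A E E) : HilbertSubmodule A E where
  toSubmodule := T.toCLM.ker
  op_smul_mem' a x hx := by
    have hx' : T x = 0 := hx
    change T (a • x) = 0
    rw [T.map_op_smul, hx']
    refine eq_of_inner_left (A := A) fun z => ?_
    simp
  isClosed' := T.toCLM.isClosed_ker

/-- The range `𝓡(P)` of a projection. -/
def projRange (P : Adjointable A E E) (hP : IsStarProjection P) : HilbertSubmodule A E where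
  toSubmodule := P.toCLM.range
  op_smul_mem' := by
    rintro a _ ⟨x, rfl⟩
    exact ⟨a • x, P.map_op_smul a x⟩
  isClosed' := by
    have h : (P.toCLM.range : Set E) = {x | P x = x} := by
      ext x
      constructor
      · rintro ⟨y, rfl⟩
        exact congrArg (fun T : Adjointable A E E => T y) hP.isIdempotentElem.eq
      · exact fun hx => ⟨x, hx⟩
    change IsClosed (P.toCLM.range : Set E)
    rw [h]
    exact isClosed_eq P.toCLM.continuous continuous_id

variable (A) in
/-- The orthogonal complement `M^⊥` with respect to the `A`-valued inner product. -/
def orthogonal (M : Submodule ℂ E) : Submodule ℂ E where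
  carrier := {x | ∀ y ∈ M, ⟪y, x⟫_A = 0}
  add_mem' {x x'} hx hx' y hy := by
    rw [CStarModule.inner_add_right, hx y hy, hx' y hy, add_zero]
  zero_mem' y _ := CStarModule.inner_zero_right
  smul_mem' c x hx y hy := by
    rw [CStarModule.inner_smul_right_complex, hx y hy, smul_zero]

variable (A) in
/-- `M` is orthogonally complemented in `E`: `E = M + M^⊥`. -/
def IsOrthComplemented (M : Submodule ℂ E) : Prop :=
  M ⊔ orthogonal A M = ⊤

/-- The closure of the range of an operator. -/
def closureRange (T : Adjointable A E E) : Submodule ℂ E :=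
  T.toCLM.range.topologicalClosure

/-! ## Harmonious quasi-projection pairs -/

/-- `(P, Q)` is a quasi-projection pair. -/
structure IsQuasiProjectionPair (P Q : Adjointable A E E) : Prop where
  isProjection : IsStarProjection P
  isIdempotent : IsIdempotentElem Q
  corner₁₁ : P * star Q * P = P * Q * P
  corner₁₂ : P * star Q * (1 - P) = -(P * Q * (1 - P))
  corner₂₂ : (1 - P) * star Q * (1 - P) = (1 - P) * Q * (1 - P)

/-- `(P, Q)` is a harmonious quasi-projection pair. -/
structure IsHarmoniousQuasiProjectionPair (P Q : Adjointable A E E) : Prop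
    extends IsQuasiProjectionPair P Q where
  complemented₅ : IsOrthComplemented A (closureRange (P * Q * (1 - P)))
  complemented₆ : IsOrthComplemented A (closureRange ((1 - P) * Q * P))

end Submodules

/-! ## Block matrices and the canonical `2 × 2` form -/

section Blocks

variable {A : Type*} [NonUnitalCStarAlgebra A] [PartialOrder A] [StarOrderedRing A]
  {E F : Type*}
  [NormedAddCommGroup E] [NormedSpace ℂ E] [SMul A E] [CStarModule A E]
  [NormedAddCommGroup F] [NormedSpace ℂ F] [SMul A F] [CStarModule A F]

/-- A bounded linear map into the direct sum `E ⊕ F`, from its two components. -/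
def pairCLM {V : Type*} [NormedAddCommGroup V] [NormedSpace ℂ V]
    (S : V →L[ℂ] E) (T : V →L[ℂ] F) : V →L[ℂ] C⋆ᵐᵒᵈ(A, E × F) :=
  ((WithCStarModule.equivL (A := A) (E := E × F) ℂ).symm : (E × F) →L[ℂ] C⋆ᵐᵒᵈ(A, E × F)).comp (S.prod T)

variable (A E F) in
/-- The coordinate projection `E ⊕ F → E`. -/
def fstCLM : C⋆ᵐᵒᵈ(A, E × F) →L[ℂ] E :=
  (ContinuousLinearMap.fst ℂ E F).comp
    (WithCStarModule.equivL (A := A) (E := E × F) ℂ : C⋆ᵐᵒᵈ(A, E × F) →L[ℂ] E × F)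

variable (A E F) in
/-- The coordinate projection `E ⊕ F → F`. -/
def sndCLM : C⋆ᵐᵒᵈ(A, E × F) →L[ℂ] F :=
  (ContinuousLinearMap.snd ℂ E F).comp
    (WithCStarModule.equivL (A := A) (E := E × F) ℂ : C⋆ᵐᵒᵈ(A, E × F) →L[ℂ] E × F)

/-- The operator on the Hilbert `A`-module `E ⊕ F` with block matrix `[[a, b], [c, d]]`. -/
def block (a : Adjointable A E E) (b : Adjointable A F E)
    (c : Adjointable A E F) (d : Adjointable A F F) :
    Adjointable A C⋆ᵐᵒᵈ(A, E × F) C⋆ᵐᵒᵈ(A, E × F) where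
  toCLM := pairCLM (a.toCLM.comp (fstCLM A E F) + b.toCLM.comp (sndCLM A E F))
    (c.toCLM.comp (fstCLM A E F) + d.toCLM.comp (sndCLM A E F))
  adjCLM := pairCLM (a.adjCLM.comp (fstCLM A E F) + c.adjCLM.comp (sndCLM A E F))
    (b.adjCLM.comp (fstCLM A E F) + d.adjCLM.comp (sndCLM A E F))
  inner_adj x y := by
    change ⟪a x.1 + b x.2, y.1⟫_A + ⟪c x.1 + d x.2, y.2⟫_A
      = ⟪x.1, a.adjCLM y.1 + c.adjCLM y.2⟫_A + ⟪x.2, b.adjCLM y.1 + d.adjCLM y.2⟫_A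
    simp only [CStarModule.inner_add_left, CStarModule.inner_add_right, a.inner_adj, b.inner_adj,
      c.inner_adj, d.inner_adj]
    abel

/-- The unitary `U_P : E → 𝓡(P) ⊕ 𝓝(P)`, `U_P x = (P x, (1 - P) x)`;
its adjoint is `(x₁, x₂) ↦ x₁ + x₂`. -/
def splitting (P : Adjointable A E E) (hP : IsStarProjection P) :
    Adjointable A E C⋆ᵐᵒᵈ(A, projRange P hP × nullSpace P) where
  toCLM := pairCLM (P.toCLM.codRestrict (projRange P hP).toSubmodule fun x => ⟨x, rfl⟩)
    ((1 - P).toCLM.codRestrict (nullSpace P).toSubmodule fun x => by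
      exact congrArg (fun T : Adjointable A E E => T x) hP.isIdempotentElem.mul_one_sub_self)
  adjCLM := (projRange P hP).toSubmodule.subtypeL.comp (fstCLM A _ _)
    + (nullSpace P).toSubmodule.subtypeL.comp (sndCLM A _ _)
  inner_adj x y := by
    have hadj : ∀ z, P.adjCLM z = P z := fun z =>
      congrArg (fun T : Adjointable A E E => T z) hP.isSelfAdjoint.star_eq
    have h1 : P (y.1 : E) = y.1 := by
      obtain ⟨w, hw⟩ := y.1.2
      rw [← hw]
      exact congrArg (fun T : Adjointable A E E => T w) hP.isIdempotentElem.eq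
    have h2 : P (y.2 : E) = 0 := y.2.2
    change ⟪P x, (y.1 : E)⟫_A + ⟪x - P x, (y.2 : E)⟫_A = ⟪x, (y.1 : E) + (y.2 : E)⟫_A
    rw [CStarModule.inner_sub_left, P.inner_adj, P.inner_adj, hadj, hadj, h1, h2,
      CStarModule.inner_add_right, CStarModule.inner_zero_right, sub_zero]

/-- `ℓ(a) = (a² - a)^{1/2}`, for a self-adjoint `a` with `a² - a ≥ 0`. -/
def ell [CompleteSpace E] (a : Adjointable A E E) : Adjointable A E E :=
  CFC.sqrt (a ^ 2 - a)

/-- `Q` has the canonical `2 × 2` block matrix representation induced by the projection `P`. -/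
def HasCanonicalRepresentation [CompleteSpace E] (P : Adjointable A E E) (hP : IsStarProjection P)
    (Q : Adjointable A E E) : Prop :=
  ∃ (a : Adjointable A (projRange P hP) (projRange P hP))
    (U : Adjointable A (projRange P hP) (nullSpace P))
    (Q₀ : Adjointable A (nullSpace P) (nullSpace P)),
    IsSelfAdjoint a ∧ 0 ≤ a ^ 2 - a ∧
    IsPartialIsometry U ∧
    IsStarProjection Q₀ ∧
    Set.range U.adjoint.toCLM = closure (Set.range (a ^ 2 - a).toCLM) ∧
    U.adjoint.comp Q₀ = 0 ∧
    ((splitting P hP).comp Q).comp (splitting P hP).adjoint =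
      block a (-((ell a).comp U.adjoint))
        (U.comp (ell a)) ((U.comp (1 - a)).comp U.adjoint + Q₀)

end Blocks

end HilbertModule

end

noncomputable section

namespace HilbertModule

/-! ### Adjointable operators and their closed ranges. -/

section General

variable {A E F G : Type*} [NonUnitalCStarAlgebra A] [PartialOrder A]
  [NormedAddCommGroup E] [NormedSpace ℂ E] [SMul A E] [CStarModule A E]
  [NormedAddCommGroup F] [NormedSpace ℂ F] [SMul A F] [CStarModule A F]
  [NormedAddCommGroup G] [NormedSpace ℂ G] [SMul A G] [CStarModule A G]

namespace Adjointable

/-! Write `Q` as a block matrix with corners `a, b, c, d` along `H = 𝓡(P) ⊕ 𝓝(P)`. The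
quasi-projection relations say that `Q` is idempotent, `a` and `d` are self-adjoint and `c* = -b`.
Harmony says that the closed ranges of `b` and `c` are complemented
(`isOrthComplemented_comp_comp_adjoint_iff`). The theorem thus becomes a statement about four
operators.

From the canonical form to the pair, everything is computation: `U*U` is the identity on the closed
range of `a² - a`, which is also that of `ℓ(a)` and is preserved by `a`. The projections `U*U` and
`UU*` witness harmony (`canonical_entries_relations`).

Conversely, the (1,1) entry of `Q² = Q` reads `a² - a = -bc = c*c`, so `a² - a ≥ 0` and `ℓ(a)` is
the absolute value of `c`. A polar decomposition `c = U ℓ(a)` exists in a Hilbert module once the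
closed ranges of `c` and `c* = -b` are complemented, which is exactly harmony
(`exists_partialIsometry_of_adjoint_comp_self_eq`). Taking adjoints gives `b = -ℓ(a)U*`. The (2,1)
entry forces `d = U(1 - a)U*` on the range of `U`, and the (2,2) entry makes the remainder `Q₀ = d(1
- UU*)` a projection (`exists_canonical_entries`).

The analytic input is that `T` and `TT*` have the same closed range
(`apply_mem_rangeClosure_comp_adjoint`) and that `T*T` is positive in the spectral order
(`adjoint_comp_self_nonneg`). -/

@[simp] theorem comp_toCLM_apply (S : Adjointable A F G) (T : Adjointable A E F) (x : E) :
    (S.comp T).toCLM x = S (T x) := rfl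

@[simp] theorem comp_adjCLM_apply (S : Adjointable A F G) (T : Adjointable A E F) (x : G) :
    (S.comp T).adjCLM x = T.adjCLM (S.adjCLM x) := rfl

@[simp] theorem adjoint_toCLM (T : Adjointable A E F) : T.adjoint.toCLM = T.adjCLM := rfl

@[simp] theorem adjoint_adjCLM (T : Adjointable A E F) : T.adjoint.adjCLM = T.toCLM := rfl

@[simp] theorem mul_toCLM_apply (S T : Adjointable A E E) (x : E) :
    (S * T).toCLM x = S (T x) := rfl

@[simp] theorem one_toCLM_apply (x : E) : (1 : Adjointable A E E).toCLM x = x := rfl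

@[simp] theorem add_toCLM_apply (S T : Adjointable A E F) (x : E) :
    (S + T).toCLM x = S x + T x := rfl

@[simp] theorem sub_toCLM_apply (S T : Adjointable A E F) (x : E) :
    (S - T).toCLM x = S x - T x := rfl

@[simp] theorem neg_toCLM_apply (T : Adjointable A E F) (x : E) : (-T).toCLM x = -T x := rfl

@[simp] theorem zero_toCLM_apply (x : E) : (0 : Adjointable A E F).toCLM x = 0 := rfl

@[simp] theorem one_adjCLM_apply (x : E) : (1 : Adjointable A E E).adjCLM x = x := rfl

@[simp] theorem add_adjCLM_apply (S T : Adjointable A E F) (x : F) :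
    (S + T).adjCLM x = S.adjCLM x + T.adjCLM x := rfl

@[simp] theorem sub_adjCLM_apply (S T : Adjointable A E F) (x : F) :
    (S - T).adjCLM x = S.adjCLM x - T.adjCLM x := rfl

@[simp] theorem neg_adjCLM_apply (T : Adjointable A E F) (x : F) :
    (-T).adjCLM x = -T.adjCLM x := rfl

theorem congr_apply {S T : Adjointable A E F} (h : S = T) (x : E) : S x = T x := by rw [h]

theorem inner_adj_left (T : Adjointable A E F) (x : F) (y : E) :
    ⟪T.adjCLM x, y⟫_A = ⟪x, T y⟫_A := T.adjoint.inner_adj x y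

theorem adjCLM_eq_of_isSelfAdjoint {T : Adjointable A E E} (hT : IsSelfAdjoint T) (x : E) :
    T.adjCLM x = T x := congr_apply hT.star_eq x

theorem isSelfAdjoint_of_adjCLM_eq {T : Adjointable A E E} (hT : ∀ x, T.adjCLM x = T x) :
    IsSelfAdjoint T := by
  ext x
  exact hT x

theorem isSelfAdjoint_comp_adjoint (T : Adjointable A E F) : IsSelfAdjoint (T.comp T.adjoint) := by
  ext x; rfl

/-- Two contractive maps that are formally adjoint to each other form an adjointable operator. -/
def ofInner (f : E → F) (g : F → E) (h : ∀ x y, ⟪f x, y⟫_A = ⟪x, g y⟫_A)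
    (hf : ∀ x, ‖f x‖ ≤ ‖x‖) (hg : ∀ y, ‖g y‖ ≤ ‖y‖) : Adjointable A E F :=
  have h' : ∀ x y, ⟪g y, x⟫_A = ⟪y, f x⟫_A := fun x y => by
    rw [← CStarModule.star_inner, ← h, CStarModule.star_inner]
  { toCLM := LinearMap.mkContinuous
      { toFun := f
        map_add' := fun x y => eq_of_inner_left (A := A) fun z => by
          simp only [CStarModule.inner_add_right, ← h']
        map_smul' := fun c x => eq_of_inner_left (A := A) fun z => by
          simp only [RingHom.id_apply, CStarModule.inner_smul_right_complex, ← h'] }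
      1 (fun x => by simpa using hf x)
    adjCLM := LinearMap.mkContinuous
      { toFun := g
        map_add' := fun x y => eq_of_inner_left (A := A) fun z => by
          simp only [CStarModule.inner_add_right, ← h]
        map_smul' := fun c x => eq_of_inner_left (A := A) fun z => by
          simp only [RingHom.id_apply, CStarModule.inner_smul_right_complex, ← h] }
      1 (fun x => by simpa using hg x)
    inner_adj := h }

end Adjointable

/-! ### Density arguments and orthogonal projections onto closed ranges. -/

open Adjointable

/-- The closure of the range of an adjointable operator. -/
def rangeClosure (T : Adjointable A E F) : Submodule ℂ F := T.toCLM.range.topologicalClosure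

theorem apply_mem_rangeClosure (T : Adjointable A E F) (x : E) : T x ∈ rangeClosure T :=
  subset_closure ⟨x, rfl⟩

theorem isClosed_rangeClosure (T : Adjointable A E F) : IsClosed (rangeClosure T : Set F) :=
  isClosed_closure

theorem coe_rangeClosure (T : Adjointable A E F) :
    (rangeClosure T : Set F) = closure (Set.range T.toCLM) := by
  rfl

theorem mem_of_mem_rangeClosure {T : Adjointable A E F} {s : Set F} (hs : IsClosed s)
    (h : ∀ x, T x ∈ s) {y : F} (hy : y ∈ rangeClosure T) : y ∈ s :=
  closure_minimal (by rintro _ ⟨x, rfl⟩; exact h x) hs hy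

theorem rangeClosure_le {T : Adjointable A E F} {S : Adjointable A G F}
    (h : ∀ x, T x ∈ rangeClosure S) : rangeClosure T ≤ rangeClosure S :=
  fun _ hy => mem_of_mem_rangeClosure (isClosed_rangeClosure S) h hy

theorem apply_eq_of_mem_rangeClosure {T : Adjointable A E F} {S R : Adjointable A F G}
    (h : ∀ x, S (T x) = R (T x)) {y : F} (hy : y ∈ rangeClosure T) : S y = R y :=
  mem_of_mem_rangeClosure (s := {y | S y = R y})
    (isClosed_eq S.toCLM.continuous R.toCLM.continuous) h hy

theorem apply_mem_rangeClosure_of_mem {D : Type*} [NormedAddCommGroup D] [NormedSpace ℂ D] [SMul A D]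
    [CStarModule A D] {T : Adjointable A E F} {S : Adjointable A F G} {R : Adjointable A D G}
    (h : ∀ x, S (T x) ∈ rangeClosure R) {y : F} (hy : y ∈ rangeClosure T) :
    S y ∈ rangeClosure R :=
  mem_of_mem_rangeClosure (s := S.toCLM ⁻¹' (rangeClosure R : Set G))
    ((isClosed_rangeClosure R).preimage S.toCLM.continuous) h hy

variable [StarOrderedRing A]

theorem inner_eq_zero_of_mem_rangeClosure {T : Adjointable A E F} {y z : F}
    (h : ∀ x, ⟪T x, z⟫_A = 0) (hy : y ∈ rangeClosure T) : ⟪y, z⟫_A = 0 :=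
  mem_of_mem_rangeClosure (s := {y | ⟪y, z⟫_A = 0})
    (isClosed_eq ((CStarModule.continuous_inner (A := A) (E := F)).comp
      (continuous_id.prodMk continuous_const)) continuous_const) h hy

/-- Cauchy–Schwarz, then cancel `‖x‖`. It makes an orthogonal projection contractive before it is
known to be linear. -/
theorem norm_le_of_inner_self_eq {x y : E} (h : ⟪x, x⟫_A = ⟪x, y⟫_A) : ‖x‖ ≤ ‖y‖ := by
  have h1 : ‖x‖ ^ 2 ≤ ‖x‖ * ‖y‖ := by
    rw [CStarModule.norm_sq_eq A, h]
    exact CStarModule.norm_inner_le E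
  rcases (norm_nonneg x).eq_or_lt with h0 | h0
  · rw [← h0]
    exact norm_nonneg y
  · rw [sq] at h1
    exact le_of_mul_le_mul_left h1 h0

/-- The closure of the range of `T` is orthogonally complemented iff there is an orthogonal
projection onto it. -/
theorem isOrthComplemented_rangeClosure_iff (T : Adjointable A E F) :
    IsOrthComplemented A (rangeClosure T) ↔ ∃ p : Adjointable A F F,
      IsSelfAdjoint p ∧ (∀ x, p (T x) = T x) ∧ ∀ y, p y ∈ rangeClosure T := by
  constructor
  · intro h
    have hdec : ∀ x : F, ∃ m ∈ rangeClosure T, x - m ∈ orthogonal A (rangeClosure T) := by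
      intro x
      have hx : x ∈ rangeClosure T ⊔ orthogonal A (rangeClosure T) := by
        rw [show rangeClosure T ⊔ orthogonal A (rangeClosure T) = ⊤ from h]
        trivial
      obtain ⟨m, hm, n, hn, rfl⟩ := Submodule.mem_sup.1 hx
      exact ⟨m, hm, by simpa using hn⟩
    -- `f` is the orthogonal projection as a bare function; additivity and homogeneity come from its
    -- being formally self-adjoint, through `ofInner`.
    choose f hf hf' using hdec
    have h1 : ∀ x y, ⟪f x, y⟫_A = ⟪f x, f y⟫_A := fun x y => by
      rw [← sub_eq_zero, ← CStarModule.inner_sub_right]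
      exact hf' y _ (hf x)
    have h2 : ∀ x y, ⟪x, f y⟫_A = ⟪f x, f y⟫_A := fun x y => by
      rw [← CStarModule.star_inner, h1, CStarModule.star_inner]
    have hn : ∀ x, ‖f x‖ ≤ ‖x‖ := fun x => norm_le_of_inner_self_eq (A := A) (h1 x x).symm
    refine ⟨ofInner f f (fun x y => by rw [h1, ← h2]) hn hn, ?_, ?_, hf⟩
    · exact isSelfAdjoint_of_adjCLM_eq fun _ => rfl
    · intro x
      have hm : T x - f (T x) ∈ rangeClosure T := sub_mem (apply_mem_rangeClosure T x) (hf _)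
      have := hf' (T x) _ hm
      rw [CStarModule.inner_self, sub_eq_zero] at this
      exact this.symm
  · rintro ⟨p, hp, hpT, hpm⟩
    refine Submodule.eq_top_iff'.2 fun x => ?_
    rw [← add_sub_cancel (p x) x]
    refine Submodule.add_mem_sup (hpm x) fun y hy => ?_
    refine inner_eq_zero_of_mem_rangeClosure (fun z => ?_) hy
    rw [CStarModule.inner_sub_right, sub_eq_zero, ← p.inner_adj_left,
      adjCLM_eq_of_isSelfAdjoint hp, hpT]

/-! ### C*-estimates, the closed range of `TT*`, positivity of `T*T`. -/

namespace Adjointable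

/-- The C*-inequality `‖R‖² ≤ ‖RR*‖` in pointwise form, for `R` between different modules.
Cauchy–Schwarz bounds `R*` by `RR*`; then `‖Ry‖² ≤ ‖y‖ ‖R*Ry‖` is squared and `‖Ry‖²` cancelled. -/
theorem norm_apply_sq_le (R : Adjointable A E F) (y : E) :
    ‖R y‖ ^ 2 ≤ ‖R.comp R.adjoint‖ * ‖y‖ ^ 2 := by
  have h1 (z : F) : ‖R.adjCLM z‖ ^ 2 ≤ ‖R.comp R.adjoint‖ * ‖z‖ ^ 2 := by
    calc ‖R.adjCLM z‖ ^ 2 = ‖⟪z, (R.comp R.adjoint) z⟫_A‖ := by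
          rw [CStarModule.norm_sq_eq A, R.inner_adj_left]; rfl
      _ ≤ ‖z‖ * ‖(R.comp R.adjoint) z‖ := CStarModule.norm_inner_le F
      _ ≤ ‖z‖ * (‖R.comp R.adjoint‖ * ‖z‖) := by
          gcongr; exact (R.comp R.adjoint).toCLM.le_opNorm z
      _ = ‖R.comp R.adjoint‖ * ‖z‖ ^ 2 := by ring
  have h2 : ‖R y‖ ^ 2 ≤ ‖y‖ * ‖R.adjCLM (R y)‖ := by
    rw [CStarModule.norm_sq_eq A, R.inner_adj]
    exact CStarModule.norm_inner_le E
  rcases (norm_nonneg (R y)).eq_or_lt with h0 | h0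
  · rw [← h0]
    simpa using mul_nonneg (norm_nonneg (R.comp R.adjoint)) (sq_nonneg ‖y‖)
  · have h3 : ‖R y‖ ^ 2 * ‖R y‖ ^ 2 ≤ ‖R.comp R.adjoint‖ * ‖y‖ ^ 2 * ‖R y‖ ^ 2 := by
      calc ‖R y‖ ^ 2 * ‖R y‖ ^ 2 ≤ (‖y‖ * ‖R.adjCLM (R y)‖) * (‖y‖ * ‖R.adjCLM (R y)‖) := by
            gcongr
        _ = ‖y‖ ^ 2 * ‖R.adjCLM (R y)‖ ^ 2 := by ring
        _ ≤ ‖y‖ ^ 2 * (‖R.comp R.adjoint‖ * ‖R y‖ ^ 2) := by gcongr; exact h1 _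
        _ = _ := by ring
    exact le_of_mul_le_mul_right h3 (by positivity)

end Adjointable

/-- In a unital C*-algebra, `s` is absorbed up to a small error by a multiple of itself. -/
theorem exists_norm_one_sub_mul_le {B : Type*} [CStarAlgebra B] {s : B} (hs : IsSelfAdjoint s)
    {ε : ℝ} (hε : 0 < ε) :
    ∃ b : B, IsSelfAdjoint (1 - s * b) ∧ ‖(1 - s * b) * s * (1 - s * b)‖ ≤ ε := by
  have hpos (t : ℝ) : t ^ 2 + ε ^ 2 ≠ 0 := by positivity
  have hc : Continuous fun t : ℝ => t / (t ^ 2 + ε ^ 2) := by fun_prop (disch := exact hpos _)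
  have hc2 : Continuous fun t : ℝ => ε ^ 2 / (t ^ 2 + ε ^ 2) := by fun_prop (disch := exact hpos _)
  -- Here `b = s/(s² + ε²)` is a regularized inverse of `s`, so `1 - sb = ε²/(s² + ε²)` is a smooth
  -- cutoff near the kernel of `s`. The bound to prove becomes `|t| ε⁴/(t² + ε²)² ≤ ε` on the
  -- spectrum.
  have he : 1 - s * cfc (fun t : ℝ => t / (t ^ 2 + ε ^ 2)) s
      = cfc (fun t : ℝ => ε ^ 2 / (t ^ 2 + ε ^ 2)) s := by
    nth_rewrite 1 [← cfc_id' ℝ s]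
    rw [← cfc_mul (fun t : ℝ => t) _ s (by fun_prop) hc.continuousOn, ← cfc_one ℝ s,
      ← cfc_sub _ _ s (by fun_prop) (by fun_prop)]
    congr 1
    ext t
    have := hpos t
    simp only [Pi.one_apply]
    field_simp
    ring
  refine ⟨cfc (fun t : ℝ => t / (t ^ 2 + ε ^ 2)) s, ?_, ?_⟩
  · rw [he]
    exact cfc_predicate _ s
  · rw [he]
    nth_rewrite 2 [← cfc_id' ℝ s]
    rw [← cfc_mul _ _ s hc2.continuousOn (by fun_prop),
      ← cfc_mul (fun t : ℝ => ε ^ 2 / (t ^ 2 + ε ^ 2) * t) _ s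
        (hc2.mul continuous_id').continuousOn hc2.continuousOn]
    refine norm_cfc_le hε.le fun t _ => ?_
    have h1 : ε ^ 2 / (t ^ 2 + ε ^ 2) ≤ 1 := by
      rw [div_le_one (by positivity)]; nlinarith [sq_nonneg t]
    have h2 : ε ^ 2 / (t ^ 2 + ε ^ 2) * |t| ≤ ε := by
      rw [div_mul_eq_mul_div, div_le_iff₀ (by positivity)]
      have : ε * |t| ≤ t ^ 2 + ε ^ 2 := by
        nlinarith [sq_nonneg (ε - |t|), sq_abs t, sq_nonneg t, sq_nonneg ε]
      nlinarith
    have h0 : 0 ≤ ε ^ 2 / (t ^ 2 + ε ^ 2) := by positivity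
    rw [norm_mul, norm_mul, Real.norm_eq_abs, Real.norm_eq_abs, abs_of_nonneg h0]
    calc _ ≤ ε * 1 := by gcongr
      _ = ε := mul_one ε

/-- `T` and `T T*` have the same closed range. -/
theorem apply_mem_rangeClosure_comp_adjoint [CompleteSpace F] (T : Adjointable A E F) (y : E) :
    T y ∈ rangeClosure (T.comp T.adjoint) := by
  set s := T.comp T.adjoint with hs
  refine Metric.mem_closure_iff.2 fun δ hδ => ?_
  -- The `+ 1` in the denominator allows `y = 0` and makes the inequality strict.
  obtain ⟨ε, hε, hεδ⟩ : ∃ ε : ℝ, 0 < ε ∧ ε * ‖y‖ ^ 2 < δ ^ 2 := by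
    refine ⟨δ ^ 2 / (‖y‖ ^ 2 + 1), by positivity, ?_⟩
    rw [div_mul_eq_mul_div, div_lt_iff₀ (by positivity)]
    nlinarith [sq_nonneg ‖y‖, pow_pos hδ 2]
  obtain ⟨b, hb, hbε⟩ := exists_norm_one_sub_mul_le (isSelfAdjoint_comp_adjoint T) hε
  -- The error is `(1 - sb)Ty`. By the C*-inequality for `R = (1 - sb)T`, its squared norm is at
  -- most `‖(1 - sb)s(1 - sb)‖ ‖y‖² ≤ ε‖y‖²`.
  refine ⟨s (b (T y)), ⟨b (T y), rfl⟩, ?_⟩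
  have h1 := norm_apply_sq_le ((1 - s * b).comp T) y
  have h2 : ((1 - s * b).comp T).comp ((1 - s * b).comp T).adjoint
      = (1 - s * b) * s * (1 - s * b) := by
    ext x
    change (1 - s * b) (T (T.adjCLM ((1 - s * b).adjCLM x))) = _
    rw [adjCLM_eq_of_isSelfAdjoint hb]
    rfl
  rw [h2] at h1
  rw [dist_eq_norm]
  have h3 : ‖T y - s (b (T y))‖ ^ 2 < δ ^ 2 := by
    refine lt_of_le_of_lt (h1.trans ?_) hεδ
    gcongr
  exact lt_of_pow_lt_pow_left₀ 2 hδ.le h3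

/-- `T* T` is positive. -/
theorem adjoint_comp_self_nonneg [CompleteSpace E] (T : Adjointable A E F) :
    0 ≤ T.adjoint.comp T := by
  set s := T.adjoint.comp T with hs
  have hsa : IsSelfAdjoint s := by ext x; rfl
  rw [← CFC.negPart_eq_zero_iff s hsa]
  have hn : IsSelfAdjoint s⁻ := (CFC.negPart_nonneg s).isSelfAdjoint
  have h1 : s * s⁻ = -(s⁻ * s⁻) := by
    nth_rewrite 1 [← CFC.posPart_sub_negPart s hsa]
    rw [sub_mul, CFC.posPart_mul_negPart, zero_sub]
  set r := CFC.sqrt s⁻ with hr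
  have hrsa : IsSelfAdjoint r := (CFC.sqrt_nonneg _).isSelfAdjoint
  have hrr : r * r = s⁻ := CFC.sqrt_mul_sqrt_self _ (CFC.negPart_nonneg s)
  -- A positive element equals the negative of a positive element, so both vanish. Hence `r s⁻ = 0`,
  -- then `(s⁻)² = r r s⁻ = 0` and `s⁻ = 0`.
  have h2 (x : E) : ⟪T (s⁻ x), T (s⁻ x)⟫_A = -⟪r (s⁻ x), r (s⁻ x)⟫_A := by
    have e1 : s (s⁻ x) = -(s⁻ (s⁻ x)) := congr_apply h1 x
    have e2 : s⁻ (s⁻ x) = r (r (s⁻ x)) := (congr_apply hrr _).symm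
    rw [T.inner_adj, r.inner_adj, adjCLM_eq_of_isSelfAdjoint hrsa, ← e2,
      ← CStarModule.inner_neg_right, ← e1]
    rfl
  have h3 (x : E) : r (s⁻ x) = 0 := by
    rw [← CStarModule.inner_self (A := A)]
    refine le_antisymm ?_ CStarModule.inner_self_nonneg
    rw [← neg_nonneg, ← h2]
    exact CStarModule.inner_self_nonneg
  have h4 : star s⁻ * s⁻ = 0 := by
    ext x
    rw [hn.star_eq]
    have e2 : s⁻ (s⁻ x) = r (r (s⁻ x)) := (congr_apply hrr _).symm
    change s⁻ (s⁻ x) = 0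
    rw [e2, h3, map_zero]
  exact CStarRing.star_mul_self_eq_zero_iff _ |>.1 h4

end General

/-! ### Polar decomposition through the closed graph `{(S z, T z)}`. -/

section Polar

open Adjointable

variable {A E F G : Type*} [NonUnitalCStarAlgebra A] [PartialOrder A]
  [NormedAddCommGroup E] [NormedSpace ℂ E] [SMul A E] [CStarModule A E]
  [NormedAddCommGroup F] [NormedSpace ℂ F] [SMul A F] [CStarModule A F]
  [NormedAddCommGroup G] [NormedSpace ℂ G] [SMul A G] [CStarModule A G]

/-- The closure of the set of pairs `(S z, T z)`. -/
def jointClosure (S : Adjointable A G E) (T : Adjointable A G F) : Submodule ℂ (E × F) :=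
  (S.toCLM.prod T.toCLM).range.topologicalClosure

theorem mk_mem_jointClosure (S : Adjointable A G E) (T : Adjointable A G F) (z : G) :
    (S z, T z) ∈ jointClosure S T :=
  subset_closure ⟨z, rfl⟩

theorem mem_of_mem_jointClosure {S : Adjointable A G E} {T : Adjointable A G F} {s : Set (E × F)}
    (hs : IsClosed s) (h : ∀ z, (S z, T z) ∈ s) {w : E × F} (hw : w ∈ jointClosure S T) : w ∈ s :=
  closure_minimal (by rintro _ ⟨z, rfl⟩; exact h z) hs hw

theorem swap_mem_jointClosure {S : Adjointable A G E} {T : Adjointable A G F} {w : E × F}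
    (hw : w ∈ jointClosure S T) : w.swap ∈ jointClosure T S :=
  mem_of_mem_jointClosure (s := Prod.swap ⁻¹' (jointClosure T S : Set (F × E)))
    (isClosed_closure.preimage continuous_swap) (fun z => mk_mem_jointClosure T S z) hw

variable [StarOrderedRing A]

/-- On the dense set both sides are `⟪z, S*S z'⟫ = ⟪z, T*T z'⟫`; continuity extends this one
variable at a time. The joint closure is therefore the graph of an inner-product-preserving
bijection. -/
theorem inner_eq_of_mem_jointClosure {S : Adjointable A G E} {T : Adjointable A G F}
    (h : ∀ z, S.adjCLM (S z) = T.adjCLM (T z)) {v w : E × F}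
    (hv : v ∈ jointClosure S T) (hw : w ∈ jointClosure S T) :
    ⟪v.1, w.1⟫_A = ⟪v.2, w.2⟫_A := by
  have hE := CStarModule.continuous_inner (A := A) (E := E)
  have hF := CStarModule.continuous_inner (A := A) (E := F)
  refine mem_of_mem_jointClosure (s := {v | ⟪v.1, w.1⟫_A = ⟪v.2, w.2⟫_A})
    (isClosed_eq (hE.comp (continuous_fst.prodMk continuous_const))
      (hF.comp (continuous_snd.prodMk continuous_const))) (fun z => ?_) hv
  refine mem_of_mem_jointClosure (s := {w | ⟪S z, w.1⟫_A = ⟪T z, w.2⟫_A})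
    (isClosed_eq (hE.comp (continuous_const.prodMk continuous_fst))
      (hF.comp (continuous_const.prodMk continuous_snd))) (fun z' => ?_) hw
  change ⟪S z, S z'⟫_A = ⟪T z, T z'⟫_A
  rw [S.inner_adj, T.inner_adj, h]

theorem norm_eq_of_mem_jointClosure {S : Adjointable A G E} {T : Adjointable A G F}
    (h : ∀ z, S.adjCLM (S z) = T.adjCLM (T z)) {v : E × F}
    (hv : v ∈ jointClosure S T) : ‖v.1‖ = ‖v.2‖ := by
  rw [CStarModule.norm_eq_sqrt_norm_inner_self (A := A) v.1,
    CStarModule.norm_eq_sqrt_norm_inner_self (A := A) v.2, inner_eq_of_mem_jointClosure h hv hv]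

/-- The first projection is isometric on the joint closure, because the two coordinates have equal
norm and the product carries the sup norm. By completeness its range is closed, and it contains
every `S z`. -/
theorem exists_mem_jointClosure [CompleteSpace E] [CompleteSpace F] {S : Adjointable A G E}
    {T : Adjointable A G F} (h : ∀ z, S.adjCLM (S z) = T.adjCLM (T z)) {x : E}
    (hx : x ∈ rangeClosure S) : ∃ y ∈ rangeClosure T, (x, y) ∈ jointClosure S T := by
  let f : jointClosure S T →ₗ[ℂ] E := (LinearMap.fst ℂ E F).comp (jointClosure S T).subtype
  have hf : Isometry f := AddMonoidHomClass.isometry_of_norm f fun v => by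
    change ‖v.1.1‖ = ‖v.1‖
    rw [Prod.norm_def, ← norm_eq_of_mem_jointClosure h v.2, max_self]
  have : CompleteSpace (jointClosure S T) := isClosed_closure.completeSpace_coe
  obtain ⟨v, hv⟩ := mem_of_mem_rangeClosure hf.isClosedEmbedding.isClosed_range
    (fun z => ⟨⟨_, mk_mem_jointClosure S T z⟩, rfl⟩) hx
  refine ⟨v.1.2, ?_, ?_⟩
  · exact mem_of_mem_jointClosure (s := Prod.snd ⁻¹' (rangeClosure T : Set F))
      ((isClosed_rangeClosure T).preimage continuous_snd) (apply_mem_rangeClosure T) v.2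
  · rw [← hv]
    exact v.2

/-- If `S* S = T* T` and the closed ranges of `S` and `T` are complemented, then `T = U S` for
a partial isometry `U` from the closed range of `S` onto that of `T`. -/
theorem exists_partialIsometry_of_adjoint_comp_self_eq [CompleteSpace E] [CompleteSpace F]
    {S : Adjointable A G E} {T : Adjointable A G F}
    (h : ∀ z, S.adjCLM (S z) = T.adjCLM (T z))
    {p : Adjointable A E E} (hp : IsSelfAdjoint p) (hpS : ∀ z, p (S z) = S z)
    (hpm : ∀ x, p x ∈ rangeClosure S)
    {q : Adjointable A F F} (hq : IsSelfAdjoint q) (hqT : ∀ z, q (T z) = T z)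
    (hqm : ∀ y, q y ∈ rangeClosure T) :
    ∃ U : Adjointable A E F, (∀ z, U (S z) = T z) ∧ (∀ x, U (p x) = U x) ∧
      (∀ x, U.adjCLM (U x) = p x) ∧ (∀ y, U (U.adjCLM y) = q y) := by
  have hpid : ∀ {x}, x ∈ rangeClosure S → p x = x := fun hx =>
    apply_eq_of_mem_rangeClosure (R := 1) hpS hx
  have hqid : ∀ {y}, y ∈ rangeClosure T → q y = y := fun hy =>
    apply_eq_of_mem_rangeClosure (R := 1) hqT hy
  have h' : ∀ z, T.adjCLM (T z) = S.adjCLM (S z) := fun z => (h z).symm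
  -- `f` will be `U` and `g` will be `U*`: project onto one closed range, then follow the graph to
  -- the other.
  choose f hfm hf using fun x => exists_mem_jointClosure h (hpm x)
  choose g hgm hg' using fun y => exists_mem_jointClosure h' (hqm y)
  have hg : ∀ y, (g y, q y) ∈ jointClosure S T := fun y => swap_mem_jointClosure (hg' y)
  -- The difference of the two pairs is `(0, y - y')`, whose coordinates have equal norm.
  have huniq : ∀ {x y y'}, (x, y) ∈ jointClosure S T → (x, y') ∈ jointClosure S T → y = y' := by
    intro x y y' hy hy'
    have := norm_eq_of_mem_jointClosure h (sub_mem hy hy')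
    simpa [eq_comm, sub_eq_zero] using this
  have huniq' : ∀ {x x' y}, (x, y) ∈ jointClosure S T → (x', y) ∈ jointClosure S T → x = x' := by
    intro x y y' hy hy'
    have := norm_eq_of_mem_jointClosure h (sub_mem hy hy')
    simpa [eq_comm, sub_eq_zero] using this
  have hpn : ∀ x, ‖p x‖ ≤ ‖x‖ := fun x => norm_le_of_inner_self_eq (A := A) <| by
    rw [p.inner_adj, p.inner_adj, adjCLM_eq_of_isSelfAdjoint hp, adjCLM_eq_of_isSelfAdjoint hp,
      hpid (hpm x)]
  have hqn : ∀ x, ‖q x‖ ≤ ‖x‖ := fun x => norm_le_of_inner_self_eq (A := A) <| by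
    rw [q.inner_adj, q.inner_adj, adjCLM_eq_of_isSelfAdjoint hq, adjCLM_eq_of_isSelfAdjoint hq,
      hqid (hqm x)]
  -- `⟪f x, y⟫ = ⟪f x, q y⟫ = ⟪p x, g y⟫ = ⟪x, g y⟫`; the middle equality compares two points of the
  -- graph.
  have hadj : ∀ x y, ⟪f x, y⟫_A = ⟪x, g y⟫_A := fun x y => by
    rw [← hqid (hfm x), q.inner_adj, adjCLM_eq_of_isSelfAdjoint hq, ← hpid (hgm y),
      ← p.inner_adj_left, adjCLM_eq_of_isSelfAdjoint hp]
    exact (inner_eq_of_mem_jointClosure h (hf x) (hg y)).symm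
  refine ⟨ofInner f g hadj
    (fun x => (norm_eq_of_mem_jointClosure h (hf x)).symm.trans_le (hpn x))
    (fun y => (norm_eq_of_mem_jointClosure h (hg y)).trans_le (hqn y)), ?_, ?_, ?_, ?_⟩
  · intro z
    refine huniq (x := S z) ?_ (mk_mem_jointClosure S T z)
    have := hf (S z)
    rw [hpS] at this
    exact this
  · intro x
    refine huniq (x := p x) ?_ (hf x)
    have := hf (p x)
    rw [hpid (hpm x)] at this
    exact this
  · intro x
    refine huniq' (y := f x) ?_ (hf x)
    have := hg (f x)
    rw [hqid (hfm x)] at this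
    exact this
  · intro y
    refine huniq (x := g y) ?_ (hg y)
    have := hf (g y)
    rw [hpid (hgm y)] at this
    exact this

end Polar

/-! ### Block calculus for an orthogonal decomposition `ii* + jj* = 1`. -/

section Corners

open Adjointable

variable {A E F H : Type*} [NonUnitalCStarAlgebra A] [PartialOrder A]
  [NormedAddCommGroup E] [NormedSpace ℂ E] [SMul A E] [CStarModule A E]
  [NormedAddCommGroup F] [NormedSpace ℂ F] [SMul A F] [CStarModule A F]
  [NormedAddCommGroup H] [NormedSpace ℂ H] [SMul A H] [CStarModule A H]

theorem sq_sub_self_apply (a : Adjointable A E E) (x : E) : (a ^ 2 - a) x = a (a x) - a x := by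
  rw [sq]; rfl

/-- The compression `i* Q j` of an operator `Q`. -/
def corner (i : Adjointable A E H) (Q : Adjointable A H H) (j : Adjointable A F H) :
    Adjointable A F E :=
  (i.adjoint.comp Q).comp j

@[simp] theorem corner_toCLM_apply (i : Adjointable A E H) (Q : Adjointable A H H)
    (j : Adjointable A F H) (x : F) : (corner i Q j).toCLM x = i.adjCLM (Q (j x)) := rfl

theorem adjoint_corner (i : Adjointable A E H) (Q : Adjointable A H H) (j : Adjointable A F H) :
    (corner i Q j).adjoint = corner j (star Q) i := rfl

/-- A pair of isometries `i : E → H` and `j : F → H` exhibiting `H` as the orthogonal direct sum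
of their ranges. -/
structure IsOrthogonalSum (i : Adjointable A E H) (j : Adjointable A F H) : Prop where
  left_isometry : ∀ x, i.adjCLM (i x) = x
  right_isometry : ∀ y, j.adjCLM (j y) = y
  sum_eq : ∀ z, i (i.adjCLM z) + j (j.adjCLM z) = z

theorem comp_comp_adjoint_injective {i : Adjointable A E H} {j : Adjointable A F H}
    (hi : ∀ x, i.adjCLM (i x) = x) (hj : ∀ x, j.adjCLM (j x) = x) {S T : Adjointable A F E} :
    (i.comp S).comp j.adjoint = (i.comp T).comp j.adjoint ↔ S = T := by
  refine ⟨fun h => ?_, fun h => by rw [h]⟩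
  ext x
  have := congrArg i.adjCLM (congr_apply h (j x))
  simpa [hi, hj] using this

namespace IsOrthogonalSum

variable {i : Adjointable A E H} {j : Adjointable A F H}

theorem ext_corner (h : IsOrthogonalSum i j) {S T : Adjointable A H H}
    (h₁₁ : corner i S i = corner i T i) (h₁₂ : corner i S j = corner i T j)
    (h₂₁ : corner j S i = corner j T i) (h₂₂ : corner j S j = corner j T j) : S = T := by
  ext z
  have e₁₁ := congr_apply h₁₁ (i.adjCLM z)
  have e₁₂ := congr_apply h₁₂ (j.adjCLM z)
  have e₂₁ := congr_apply h₂₁ (i.adjCLM z)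
  have e₂₂ := congr_apply h₂₂ (j.adjCLM z)
  simp only [corner_toCLM_apply] at e₁₁ e₁₂ e₂₁ e₂₂
  rw [← h.sum_eq z, map_add, map_add, ← h.sum_eq (S _), ← h.sum_eq (S (j _)), e₁₁, e₁₂, e₂₁, e₂₂,
    h.sum_eq, h.sum_eq]

/-- Insert `1 = ii* + jj*` between `S` and `T`: this is block matrix multiplication. -/
theorem corner_mul {D D' : Type*} [NormedAddCommGroup D] [NormedSpace ℂ D] [SMul A D]
    [CStarModule A D] [NormedAddCommGroup D'] [NormedSpace ℂ D'] [SMul A D'] [CStarModule A D']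
    (h : IsOrthogonalSum i j) (k : Adjointable A D H) (l : Adjointable A D' H)
    (S T : Adjointable A H H) :
    corner k (S * T) l
      = (corner k S i).comp (corner i T l) + (corner k S j).comp (corner j T l) := by
  ext x
  simp only [corner_toCLM_apply, mul_toCLM_apply, add_toCLM_apply, comp_toCLM_apply]
  rw [← map_add, ← map_add, h.sum_eq]

theorem isIdempotentElem_iff (h : IsOrthogonalSum i j) {Q : Adjointable A H H}
    {a : Adjointable A E E} {b : Adjointable A F E} {c : Adjointable A E F}
    {d : Adjointable A F F} (ha : corner i Q i = a) (hb : corner i Q j = b)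
    (hc : corner j Q i = c) (hd : corner j Q j = d) :
    IsIdempotentElem Q ↔ a.comp a + b.comp c = a ∧ a.comp b + b.comp d = b ∧
      c.comp a + d.comp c = c ∧ c.comp b + d.comp d = d := by
  subst ha hb hc hd
  simp only [← h.corner_mul]
  constructor
  · intro hQ
    simp only [hQ.eq, and_self]
  · rintro ⟨h₁₁, h₁₂, h₂₁, h₂₂⟩
    exact h.ext_corner h₁₁ h₁₂ h₂₁ h₂₂

/-- Each compression such as `PT(1 - P)` equals `i(i*Tj)j*`, and `i`, `j*` cancel because `i`, `j`
are isometries. Adjunction swaps the off-diagonal corners, so the (1,2) corner of `Q*` is `c*`. -/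
theorem isQuasiProjectionPair_iff (h : IsOrthogonalSum i j) {P Q : Adjointable A H H}
    (hP : IsStarProjection P) (hPi : P = i.comp i.adjoint) (hPj : 1 - P = j.comp j.adjoint)
    {a : Adjointable A E E} {b : Adjointable A F E} {c : Adjointable A E F}
    {d : Adjointable A F F} (ha : corner i Q i = a) (hb : corner i Q j = b)
    (hc : corner j Q i = c) (hd : corner j Q j = d) :
    IsQuasiProjectionPair P Q ↔ IsIdempotentElem Q ∧ a.adjoint = a ∧ c.adjoint = -b ∧
      d.adjoint = d := by
  have e₁₁ (T : Adjointable A H H) : P * T * P = (i.comp (corner i T i)).comp i.adjoint := by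
    rw [hPi]; rfl
  have e₁₂ (T : Adjointable A H H) :
      P * T * (1 - P) = (i.comp (corner i T j)).comp j.adjoint := by
    rw [hPj, hPi]; rfl
  have e₂₂ (T : Adjointable A H H) :
      (1 - P) * T * (1 - P) = (j.comp (corner j T j)).comp j.adjoint := by
    rw [hPj]; rfl
  have c₁₁ : P * star Q * P = P * Q * P ↔ a.adjoint = a := by
    rw [e₁₁, e₁₁, comp_comp_adjoint_injective h.left_isometry h.left_isometry, ← adjoint_corner, ha]
  have c₁₂ : P * star Q * (1 - P) = -(P * Q * (1 - P)) ↔ c.adjoint = -b := by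
    have : -((i.comp (corner i Q j)).comp j.adjoint)
        = (i.comp (-corner i Q j)).comp j.adjoint := by
      ext x; simp
    rw [e₁₂, e₁₂, this, comp_comp_adjoint_injective h.left_isometry h.right_isometry,
      ← adjoint_corner, hc, hb]
  have c₂₂ : (1 - P) * star Q * (1 - P) = (1 - P) * Q * (1 - P) ↔ d.adjoint = d := by
    rw [e₂₂, e₂₂, comp_comp_adjoint_injective h.right_isometry h.right_isometry,
      ← adjoint_corner, hd]
  rw [← c₁₁, ← c₁₂, ← c₂₂]
  exact ⟨fun h => ⟨h.2, h.3, h.4, h.5⟩, fun h => ⟨hP, h.1, h.2.1, h.2.2.1, h.2.2.2⟩⟩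

end IsOrthogonalSum

/-- Complementedness of the closed range is invariant under isometric embeddings. -/
theorem isOrthComplemented_comp_comp_adjoint_iff [StarOrderedRing A] {i : Adjointable A E H}
    {j : Adjointable A F H}
    (hi : ∀ x, i.adjCLM (i x) = x) (hj : ∀ x, j.adjCLM (j x) = x) (R : Adjointable A F E) :
    IsOrthComplemented A (rangeClosure ((i.comp R).comp j.adjoint)) ↔
      IsOrthComplemented A (rangeClosure R) := by
  rw [isOrthComplemented_rangeClosure_iff, isOrthComplemented_rangeClosure_iff]
  constructor
  · rintro ⟨p, hp, hpR, hpm⟩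
    -- The projection `p` on the large module is compressed to `i*pi`; in the other direction it is
    -- inflated to `ipi*`.
    refine ⟨corner i p i, ?_, fun x => ?_, fun x => ?_⟩
    · change (corner i p i).adjoint = _
      rw [adjoint_corner, hp.star_eq]
    · have := hpR (j x)
      simp only [comp_toCLM_apply, adjoint_toCLM, hj] at this
      simp only [corner_toCLM_apply, this, hi]
    · refine apply_mem_rangeClosure_of_mem (S := i.adjoint) (fun z => ?_) (hpm (i x))
      simp only [comp_toCLM_apply, adjoint_toCLM, hi]
      exact apply_mem_rangeClosure R _
  · rintro ⟨p, hp, hpR, hpm⟩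
    refine ⟨(i.comp p).comp i.adjoint, ?_, fun x => ?_, fun x => ?_⟩
    · refine isSelfAdjoint_of_adjCLM_eq fun x => ?_
      simp [adjCLM_eq_of_isSelfAdjoint hp]
    · simp [hi, hpR]
    · refine apply_mem_rangeClosure_of_mem (S := i) (fun z => ?_) (hpm (i.adjCLM x))
      have := apply_mem_rangeClosure ((i.comp R).comp j.adjoint) (j z)
      simpa [hj] using this

end Corners

/-! ### The algebra of the canonical entries. -/

section Canonical

open Adjointable

variable {A E F : Type*} [NonUnitalCStarAlgebra A] [PartialOrder A] [StarOrderedRing A]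
  [NormedAddCommGroup E] [NormedSpace ℂ E] [SMul A E] [CStarModule A E] [CompleteSpace E]
  [NormedAddCommGroup F] [NormedSpace ℂ F] [SMul A F] [CStarModule A F]

theorem isSelfAdjoint_ell (a : Adjointable A E E) : IsSelfAdjoint (ell a) :=
  (CFC.sqrt_nonneg _).isSelfAdjoint

theorem ell_mul_ell {a : Adjointable A E E} (ha : 0 ≤ a ^ 2 - a) :
    ell a * ell a = a ^ 2 - a :=
  CFC.sqrt_mul_sqrt_self _ ha

theorem ell_apply_ell_apply {a : Adjointable A E E} (ha : 0 ≤ a ^ 2 - a) (x : E) :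
    ell a (ell a x) = a (a x) - a x := by
  rw [← sq_sub_self_apply, ← ell_mul_ell ha]; rfl

theorem commute_ell (a : Adjointable A E E) : Commute (ell a) a := by
  refine Commute.cfcₙ_nnreal ?_ _
  exact ((Commute.refl a).pow_left 2).sub_left (Commute.refl a)

theorem ell_apply_apply (a : Adjointable A E E) (x : E) : ell a (a x) = a (ell a x) :=
  congr_apply (commute_ell a).eq x

/-- Since `ℓ(a)ℓ(a)* = a² - a`, this is the coincidence of the closed ranges of `T` and `TT*`. -/
theorem rangeClosure_ell {a : Adjointable A E E} (ha : 0 ≤ a ^ 2 - a) :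
    rangeClosure (ell a) = rangeClosure (a ^ 2 - a) := by
  apply le_antisymm
  · refine rangeClosure_le fun x => ?_
    have := apply_mem_rangeClosure_comp_adjoint (ell a) x
    rwa [← ell_mul_ell ha, show ell a * ell a = (ell a).comp (ell a).adjoint from
      congrArg ((ell a).comp ·) (isSelfAdjoint_ell a).star_eq.symm]
  · refine rangeClosure_le fun x => ?_
    rw [← ell_mul_ell ha]
    exact apply_mem_rangeClosure (ell a) _

/-- The entries of a canonical block matrix satisfy the relations that define a harmonious
quasi-projection pair. -/
theorem canonical_entries_relations {a : Adjointable A E E} {U : Adjointable A E F}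
    {Q₀ : Adjointable A F F} (ha : IsSelfAdjoint a) (ha0 : 0 ≤ a ^ 2 - a)
    (hU : IsPartialIsometry U) (hQ₀ : IsStarProjection Q₀)
    (hr : Set.range U.adjoint.toCLM = closure (Set.range (a ^ 2 - a).toCLM))
    (hUQ : U.adjoint.comp Q₀ = 0) {b : Adjointable A F E} {c : Adjointable A E F}
    {d : Adjointable A F F} (hb : b = -((ell a).comp U.adjoint)) (hc : c = U.comp (ell a))
    (hd : d = (U.comp (1 - a)).comp U.adjoint + Q₀) :
    (a.comp a + b.comp c = a ∧ a.comp b + b.comp d = b ∧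
      c.comp a + d.comp c = c ∧ c.comp b + d.comp d = d) ∧
    (a.adjoint = a ∧ c.adjoint = -b ∧ d.adjoint = d) ∧
    IsOrthComplemented A (rangeClosure b) ∧ IsOrthComplemented A (rangeClosure c) := by
  have hmem (y : F) : U.adjCLM y ∈ rangeClosure (a ^ 2 - a) := by
    rw [← SetLike.mem_coe, coe_rangeClosure, ← hr]
    exact ⟨y, rfl⟩
  have hUUU' (y : F) : U.adjCLM (U (U.adjCLM y)) = U.adjCLM y :=
    congr_apply (congrArg adjoint hU) y
  have hfix {x : E} (hx : x ∈ rangeClosure (a ^ 2 - a)) : U.adjCLM (U x) = x := by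
    rw [← SetLike.mem_coe, coe_rangeClosure, ← hr] at hx
    obtain ⟨y, rfl⟩ := hx
    exact hUUU' y
  have hl := adjCLM_eq_of_isSelfAdjoint (isSelfAdjoint_ell a)
  have haa := adjCLM_eq_of_isSelfAdjoint ha
  have hUl (x : E) : U.adjCLM (U (ell a x)) = ell a x := by
    refine hfix ?_
    rw [← rangeClosure_ell ha0]
    exact apply_mem_rangeClosure _ x
  -- The adjoint of `U*U ℓ(a) = ℓ(a)`.
  have hlU (x : E) : ell a (U.adjCLM (U x)) = ell a x := by
    have : ((U.adjoint.comp U).comp (ell a)).adjoint = (ell a).adjoint :=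
      congrArg adjoint (ext hUl)
    have := congr_apply this x
    simpa [hl] using this
  -- `a` commutes with `a² - a`, hence preserves its closed range, where `U*U` is the identity.
  have hUa (y : F) : U.adjCLM (U (a (U.adjCLM y))) = a (U.adjCLM y) := by
    refine hfix ?_
    refine apply_mem_rangeClosure_of_mem (fun z => ?_) (hmem y)
    have : a ((a ^ 2 - a) z) = (a ^ 2 - a) (a z) := by
      simp only [sq_sub_self_apply, map_sub]
    rw [this]
    exact apply_mem_rangeClosure _ _
  have hUQ' (y : F) : U.adjCLM (Q₀ y) = 0 := congr_apply hUQ y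
  have hqa := adjCLM_eq_of_isSelfAdjoint hQ₀.isSelfAdjoint
  have hQU (x : E) : Q₀ (U x) = 0 := by
    have := congr_apply (congrArg adjoint hUQ) x
    rw [← hqa]
    exact this
  have hQQ (y : F) : Q₀ (Q₀ y) = Q₀ y := congr_apply hQ₀.isIdempotentElem.eq y
  have hll := ell_apply_ell_apply ha0
  have hla := ell_apply_apply a
  subst hb hc hd
  refine ⟨⟨?_, ?_, ?_, ?_⟩, ⟨ha.star_eq, ?_, ?_⟩, ?_, ?_⟩
  · ext x
    simp [hUl, hll]
  · ext x
    simp [hlU, hla, hUQ']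
    abel
  · ext x
    simp [hUl, hla, hQU]
  · ext x
    simp [hll, hUUU', hUa, hUQ', hQU, hQQ]
    abel
  · ext x
    simp [hl]
  · ext x
    simp [haa, hqa]
  · rw [isOrthComplemented_rangeClosure_iff]
    refine ⟨U.adjoint.comp U, rfl, fun y => ?_, fun x => ?_⟩
    · simp [hUl]
    · refine rangeClosure_le (fun z => ?_) (hmem (U x))
      -- `b(-U ℓ(a) z) = ℓ(a) U*U ℓ(a) z = (a² - a) z`, so the range of `a² - a` lies in that of
      -- `b`.
      have := apply_mem_rangeClosure (-((ell a).comp U.adjoint)) (-U (ell a z))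
      simpa only [neg_toCLM_apply, comp_toCLM_apply, adjoint_toCLM, map_neg, neg_neg, hUl,
        hll, sq_sub_self_apply] using this
  · rw [isOrthComplemented_rangeClosure_iff]
    refine ⟨U.comp U.adjoint, rfl, fun y => ?_, fun x => ?_⟩
    · simp [hUl]
    · refine apply_mem_rangeClosure_of_mem (S := U) (fun z => ?_) (hmem x)
      rw [← ell_mul_ell ha0]
      exact apply_mem_rangeClosure (U.comp (ell a)) (ell a z)

/-- `U` is the polar part of `c`, whose absolute value is `ℓ(a)`, and `Q₀` is what remains of `d`
off the range of `U`. The (1,2) equation `ab + bd = b` is the adjoint of the (2,1) equation, so it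
carries no further information. -/
theorem exists_canonical_entries [CompleteSpace F] {a : Adjointable A E E} {b : Adjointable A F E}
    {c : Adjointable A E F} {d : Adjointable A F F}
    (h₁₁ : a.comp a + b.comp c = a) (h₂₁ : c.comp a + d.comp c = c)
    (h₂₂ : c.comp b + d.comp d = d) (ha : a.adjoint = a) (hcb : c.adjoint = -b)
    (hd : d.adjoint = d) (hbm : IsOrthComplemented A (rangeClosure b))
    (hcm : IsOrthComplemented A (rangeClosure c)) :
    ∃ (U : Adjointable A E F) (Q₀ : Adjointable A F F), 0 ≤ a ^ 2 - a ∧ IsPartialIsometry U ∧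
      IsStarProjection Q₀ ∧
      Set.range U.adjoint.toCLM = closure (Set.range (a ^ 2 - a).toCLM) ∧
      U.adjoint.comp Q₀ = 0 ∧ b = -((ell a).comp U.adjoint) ∧ c = U.comp (ell a) ∧
      d = (U.comp (1 - a)).comp U.adjoint + Q₀ := by
  have haa := adjCLM_eq_of_isSelfAdjoint (T := a) ha
  have hca (y : F) : c.adjCLM y = -b y := congr_apply hcb y
  have hba (x : E) : b.adjCLM x = -c x := by
    have := congr_apply (congrArg adjoint hcb) x
    simpa [eq_neg_iff_add_eq_zero, add_comm] using this
  have hda := adjCLM_eq_of_isSelfAdjoint (T := d) hd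
  have hcc : a ^ 2 - a = c.adjoint.comp c := by
    ext x
    have := congr_apply h₁₁ x
    simp only [add_toCLM_apply, comp_toCLM_apply] at this
    rw [sq_sub_self_apply, comp_toCLM_apply, adjoint_toCLM, hca, sub_eq_iff_eq_add,
      eq_neg_add_iff_add_eq, add_comm, this]
  have ha0 : 0 ≤ a ^ 2 - a := hcc ▸ adjoint_comp_self_nonneg c
  have hl := adjCLM_eq_of_isSelfAdjoint (isSelfAdjoint_ell a)
  have hll := ell_apply_ell_apply ha0
  have hcc' (x : E) : ell a (ell a x) = c.adjCLM (c x) := by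
    rw [hll, ← sq_sub_self_apply, hcc]; rfl
  have hla := ell_apply_apply a
  obtain ⟨p, hp, hpb, hpm⟩ := (isOrthComplemented_rangeClosure_iff b).1 hbm
  obtain ⟨q, hq, hqc, hqm⟩ := (isOrthComplemented_rangeClosure_iff c).1 hcm
  -- This and `hpml` identify the closed ranges of `b` and `ℓ(a)`: `ℓ(a)² = c*c = -bc` gives one
  -- inclusion, `bb* = ℓ(a)²` the other. Thus `p` projects onto the closed range of `ℓ(a)`.
  have hpl (x : E) : p (ell a x) = ell a x := by
    have hx : ell a x ∈ rangeClosure (a ^ 2 - a) := by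
      rw [← rangeClosure_ell ha0]
      exact apply_mem_rangeClosure _ x
    refine apply_eq_of_mem_rangeClosure (R := 1) (fun z => ?_) hx
    simp [hcc, hca, hpb]
  have hpml (x : E) : p x ∈ rangeClosure (ell a) := by
    refine rangeClosure_le (fun z => ?_) (hpm x)
    refine rangeClosure_le (fun y => ?_) (apply_mem_rangeClosure_comp_adjoint b z)
    have : (b.comp b.adjoint) y = ell a (ell a y) := by simp [hba, hcc', hca]
    rw [this]
    exact apply_mem_rangeClosure _ _
  obtain ⟨U, hUl, hUp, hUU, hUU'⟩ := exists_partialIsometry_of_adjoint_comp_self_eq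
    (fun z => by rw [hl, hcc']) hp hpl hpml hq hqc hqm
  have hpU (y : F) : p (U.adjCLM y) = U.adjCLM y := by
    have : (U.comp p).adjoint = U.adjoint := congrArg adjoint (ext hUp)
    rw [← adjCLM_eq_of_isSelfAdjoint hp]
    exact congr_apply this y
  have hUm (y : F) : U.adjCLM y ∈ rangeClosure (ell a) := by
    rw [← hpU]
    exact hpml _
  have hlU (y : F) : ell a (U.adjCLM y) = -b y := by
    have : (U.comp (ell a)).adjoint = c.adjoint := congrArg adjoint (ext hUl)
    have := congr_apply this y
    simpa [hl, hca] using this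
  -- From `dc = c - ca` and `c = U ℓ(a)`, `dU = U(1 - a)` on the range of `ℓ(a)`, hence on its
  -- closure, which contains `U* y`.
  have hdU (y : F) : d (U (U.adjCLM y)) = U (U.adjCLM y) - U (a (U.adjCLM y)) := by
    have := apply_eq_of_mem_rangeClosure (T := ell a) (S := d.comp U) (R := U.comp (1 - a))
      (fun x => ?_) (hUm y)
    · simpa using this
    · have := congr_apply h₂₁ x
      simp only [add_toCLM_apply, comp_toCLM_apply] at this
      simp only [comp_toCLM_apply, sub_toCLM_apply, one_toCLM_apply, map_sub, ← hla, hUl]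
      rw [eq_sub_iff_add_eq, add_comm, this]
  have hUd (y : F) : U (U.adjCLM (d y)) = U (U.adjCLM y) - U (a (U.adjCLM y)) := by
    have : (d.comp (U.comp U.adjoint)).adjoint
        = (U.comp U.adjoint - (U.comp a).comp U.adjoint).adjoint := congrArg adjoint (ext hdU)
    have := congr_apply this y
    simpa [hda, haa] using this
  have hUUU (x : E) : U (U.adjCLM (U x)) = U x := by rw [hUU, hUp]
  have hUUU' (y : F) : U.adjCLM (U (U.adjCLM y)) = U.adjCLM y := by rw [hUU, hpU]
  have hbU (y : F) : b (U (U.adjCLM y)) = b y := by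
    rw [← neg_inj, ← hlU, ← hlU, hUUU']
  refine ⟨U, d - (U.comp (1 - a)).comp U.adjoint, ha0, ext hUUU, ⟨?_, ?_⟩, ?_, ?_, ?_,
    (ext hUl).symm, by abel⟩
  -- With `e = UU*`, `Q₀ = d(1 - e)` and `d` commutes with `e`. Subtract the (2,2) equation at `e y`
  -- from that at `y`: as `be = b`, the `cb` terms cancel, leaving `d²(1 - e) = d(1 - e)`.
  · ext y
    have h1 := congr_apply h₂₂ y
    simp only [add_toCLM_apply, comp_toCLM_apply] at h1
    have h2 := congr_apply h₂₂ (U (U.adjCLM y))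
    simp only [add_toCLM_apply, comp_toCLM_apply, hbU] at h2
    have h3 : (d - (U.comp (1 - a)).comp U.adjoint) = d - d.comp (U.comp U.adjoint) := by
      ext z
      simp [hdU]
    have h4 (z : F) : d (U (U.adjCLM z)) = U (U.adjCLM (d z)) := by rw [hdU, hUd]
    rw [h3]
    simp only [mul_toCLM_apply, sub_toCLM_apply, comp_toCLM_apply, adjoint_toCLM, map_sub]
    rw [← h4, ← h4, hUUU, sub_self, sub_zero]
    have := congrArg₂ (· - ·) h1 h2
    simpa only [add_sub_add_left_eq_sub] using this
  · refine isSelfAdjoint_of_adjCLM_eq fun x => ?_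
    simp [haa, hda]
  · rw [← coe_rangeClosure, ← rangeClosure_ell ha0]
    apply Set.Subset.antisymm
    · rintro _ ⟨y, rfl⟩
      exact hUm y
    -- `U*U = p` fixes the closed range of `ℓ(a)`, so `x = U*(U x)`.
    · intro x hx
      refine ⟨U x, ?_⟩
      rw [adjoint_toCLM, hUU]
      exact apply_eq_of_mem_rangeClosure (R := 1) hpl hx
  · ext y
    have : U.adjCLM (d y) = U.adjCLM (d (U (U.adjCLM y))) := by
      rw [← hUUU' (d y), hUd, hdU]
    simp [this, hdU]
  · ext y
    simp [hlU]

end Canonical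

/-! ### The decomposition given by the range and null space of `P`. -/

section Splitting

open Adjointable

variable {A H : Type*} [NonUnitalCStarAlgebra A] [PartialOrder A]
  [NormedAddCommGroup H] [NormedSpace ℂ H] [SMul A H] [CStarModule A H]

theorem apply_coe_projRange {P : Adjointable A H H} (hP : IsStarProjection P)
    (x : projRange P hP) : P (x : H) = x := by
  obtain ⟨_, w, rfl⟩ := x
  exact congr_apply hP.isIdempotentElem.eq w

/-- The inclusion of the range of a projection, with adjoint `x ↦ P x`. -/
def rangeIncl (P : Adjointable A H H) (hP : IsStarProjection P) :
    Adjointable A (projRange P hP) H where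
  toCLM := (projRange P hP).toSubmodule.subtypeL
  adjCLM := P.toCLM.codRestrict (projRange P hP).toSubmodule fun x => ⟨x, rfl⟩
  inner_adj x y := by
    change ⟪(x : H), y⟫_A = ⟪(x : H), P y⟫_A
    rw [← P.inner_adj_left, adjCLM_eq_of_isSelfAdjoint hP.isSelfAdjoint, apply_coe_projRange]

/-- The inclusion of the null space of a projection, with adjoint `x ↦ (1 - P) x`. -/
def nullIncl (P : Adjointable A H H) (hP : IsStarProjection P) :
    Adjointable A (nullSpace P) H where
  toCLM := (nullSpace P).toSubmodule.subtypeL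
  adjCLM := (1 - P).toCLM.codRestrict (nullSpace P).toSubmodule fun x =>
    congr_apply hP.isIdempotentElem.mul_one_sub_self x
  inner_adj x y := by
    have hx : P (x : H) = 0 := x.2
    change ⟪(x : H), y⟫_A = ⟪(x : H), y - P y⟫_A
    rw [CStarModule.inner_sub_right, ← P.inner_adj_left,
      adjCLM_eq_of_isSelfAdjoint hP.isSelfAdjoint, hx, CStarModule.inner_zero_left, sub_zero]

theorem isOrthogonalSum_incl {P : Adjointable A H H} (hP : IsStarProjection P) :
    IsOrthogonalSum (rangeIncl P hP) (nullIncl P hP) where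
  left_isometry x := Subtype.ext (apply_coe_projRange hP x)
  right_isometry x := Subtype.ext <| by
    have hx : P (x : H) = 0 := x.2
    change (x : H) - P (x : H) = x
    rw [hx, sub_zero]
  sum_eq x := add_sub_cancel (P x) x

theorem eq_rangeIncl_comp_adjoint {P : Adjointable A H H} (hP : IsStarProjection P) :
    P = (rangeIncl P hP).comp (rangeIncl P hP).adjoint := by
  ext x; rfl

theorem one_sub_eq_nullIncl_comp_adjoint {P : Adjointable A H H} (hP : IsStarProjection P) :
    1 - P = (nullIncl P hP).comp (nullIncl P hP).adjoint := by
  ext x; rfl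

/-- The components of `U_P` are `i*` and `j*`, and `U_P*` sends `(x, y)` to `i x + j y`. Evaluating
at `(x, 0)` and `(0, y)` isolates the four corners. -/
theorem splitting_conj_eq_block_iff [StarOrderedRing A] {P : Adjointable A H H}
    (hP : IsStarProjection P) (Q : Adjointable A H H)
    (a : Adjointable A (projRange P hP) (projRange P hP))
    (b : Adjointable A (nullSpace P) (projRange P hP))
    (c : Adjointable A (projRange P hP) (nullSpace P))
    (d : Adjointable A (nullSpace P) (nullSpace P)) :
    ((splitting P hP).comp Q).comp (splitting P hP).adjoint = block a b c d ↔
      corner (rangeIncl P hP) Q (rangeIncl P hP) = a ∧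
      corner (rangeIncl P hP) Q (nullIncl P hP) = b ∧
      corner (nullIncl P hP) Q (rangeIncl P hP) = c ∧
      corner (nullIncl P hP) Q (nullIncl P hP) = d := by
  set i := rangeIncl P hP with hi
  set j := nullIncl P hP with hj
  constructor
  · intro h
    have key (x : projRange P hP) (y : nullSpace P) :
        i.adjCLM (Q (i x + j y)) = a x + b y ∧ j.adjCLM (Q (i x + j y)) = c x + d y := by
      have hxy := congr_apply h ((WithCStarModule.equiv A _).symm (x, y))
      exact ⟨congrArg (fun z => z.1) hxy, congrArg (fun z => z.2) hxy⟩
    refine ⟨?_, ?_, ?_, ?_⟩ <;> ext x : 1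
    · simpa using (key x 0).1
    · simpa using (key 0 x).1
    · simpa using (key x 0).2
    · simpa using (key 0 x).2
  · rintro ⟨rfl, rfl, rfl, rfl⟩
    ext z : 1
    refine (WithCStarModule.equiv A _).injective (Prod.ext ?_ ?_)
    · change i.adjCLM (Q (i z.1 + j z.2)) = i.adjCLM (Q (i z.1)) + i.adjCLM (Q (j z.2))
      rw [map_add, map_add]
    · change j.adjCLM (Q (i z.1 + j z.2)) = j.adjCLM (Q (i z.1)) + j.adjCLM (Q (j z.2))
      rw [map_add, map_add]

end Splitting

end HilbertModule

end

/-! ### The equivalence. -/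

open HilbertModule in
theorem mainTheorem1 {A H : Type*} [NonUnitalCStarAlgebra A] [PartialOrder A] [StarOrderedRing A]
    [NormedAddCommGroup H] [NormedSpace ℂ H] [SMul A H] [CStarModule A H] [CompleteSpace H]
    (P : HilbertModule.Adjointable A H H) (hP : IsStarProjection P) (hP0 : P ≠ 0) (hP1 : P ≠ 1)
    (Q : HilbertModule.Adjointable A H H) :
    HilbertModule.HasCanonicalRepresentation P hP Q ↔
      HilbertModule.IsHarmoniousQuasiProjectionPair P Q := by
  have hs := isOrthogonalSum_incl hP
  have hi := eq_rangeIncl_comp_adjoint hP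
  have hj := one_sub_eq_nullIncl_comp_adjoint hP
  -- `PQ(1 - P)` is the corner `i*Qj` carried back to `H` by the isometries `i` and `j`.
  have e₁₂ : IsOrthComplemented A (closureRange (P * Q * (1 - P))) ↔ IsOrthComplemented A
      (rangeClosure (corner (rangeIncl P hP) Q (nullIncl P hP))) := by
    rw [← isOrthComplemented_comp_comp_adjoint_iff hs.left_isometry hs.right_isometry, hj]
    rfl
  have e₂₁ : IsOrthComplemented A (closureRange ((1 - P) * Q * P)) ↔ IsOrthComplemented A
      (rangeClosure (corner (nullIncl P hP) Q (rangeIncl P hP))) := by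
    rw [← isOrthComplemented_comp_comp_adjoint_iff hs.right_isometry hs.left_isometry, hj]
    rfl
  constructor
  · rintro ⟨a, U, Q₀, ha, ha0, hU, hQ₀, hr, hUQ, hblock⟩
    rw [splitting_conj_eq_block_iff] at hblock
    obtain ⟨h₁₁, h₁₂, h₂₁, h₂₂⟩ := hblock
    obtain ⟨hidem, hsym, hb, hc⟩ :=
      canonical_entries_relations ha ha0 hU hQ₀ hr hUQ rfl rfl rfl
    refine ⟨?_, ?_, ?_⟩
    · rw [hs.isQuasiProjectionPair_iff hP hi hj h₁₁ h₁₂ h₂₁ h₂₂,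
        hs.isIdempotentElem_iff h₁₁ h₁₂ h₂₁ h₂₂]
      exact ⟨hidem, hsym⟩
    · rw [e₁₂, h₁₂]
      exact hb
    · rw [e₂₁, h₂₁]
      exact hc
  · rintro ⟨hq, h₅, h₆⟩
    rw [hs.isQuasiProjectionPair_iff hP hi hj rfl rfl rfl rfl,
      hs.isIdempotentElem_iff rfl rfl rfl rfl] at hq
    obtain ⟨⟨h₁₁, -, h₂₁, h₂₂⟩, ha, hc, hd⟩ := hq
    obtain ⟨U, Q₀, ha0, hU, hQ₀, hr, hUQ, hb', hc', hd'⟩ :=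
      exists_canonical_entries h₁₁ h₂₁ h₂₂ ha hc hd (e₁₂.1 h₅) (e₂₁.1 h₆)
    exact ⟨_, U, Q₀, ha, ha0, hU, hQ₀, hr, hUQ,
      (splitting_conj_eq_block_iff hP Q _ _ _ _).2 ⟨rfl, hb', hc', hd'⟩⟩
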